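/- Theorem 1.3 (Ergodic theorem for random reduced dynamics processes). Let $d\in\mathbb N$ and equip $\mathbb C^d$ with the Euclidean norm $\|\cdot\|$ and an inner product linear in the second factor; write $|\varphi\rangle\langle\chi|$ for the operator $x\mapsto\langle\chi,x\rangle\varphi$, and $\mathbb 1$ for the identity. For a linear operator $A$ on $\mathbb C^d$ let $P_{1,A}$ denote its spectral projection for the eigenvalue $1$, i.e. the projection onto the generalized eigenspace of $A$ at $1$ along the sum of its other generalized eigenspaces. Let $(\Omega,\mathcal F,\mathrm p)$ be a probability space. A measurable map $M:\Omega\to M_d(\mathbb C)$ is a *random reduced dynamics operator* (RRDO) if (1) there is a norm $|||\cdot|||$ on $\mathbb C^d$ with $|||M(\omega)x|||\le|||x|||$ for all $\omega\in\Omega$ and $x\in\mathbb C^d$, and (2) there is a vector $\psi_{\mathcal S}$, independent of $\omega$, with $\|\psi_{\mathcal S}\|=1$ and $M(\omega)\psi_{\mathcal S}=\psi_{\mathcal S}$ for all $\omega$. Let $\mathcal M_{(E)}$ be the set of (deterministic) matrices $A$ which are RRDOs when viewed as constant maps and whose spectrum on the complex unit circle consists only of the simple eigenvalue $1$. Put $$\psi(\omega)=P_{1,M(\omega)}^*\psi_{\mathcal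 S},\qquad Q(\omega)=\mathbb 1-|\psi_{\mathcal S}\rangle\langle\psi(\omega)|,\qquad M_Q(\omega)=Q(\omega)M(\omega)Q(\omega),$$ and let $\mathbb E[f]=\int_\Omega f\,d\mathrm p$. Let $M$ be an RRDO with $\mathrm p(M(\omega)\in\mathcal M_{(E)})>0$. Then $M$, $\psi$ and $M_Q$ are integrable, $\mathbb 1-\mathbb E[M_Q]^*$ is invertible, and the vector $\theta:=(\mathbb 1-\mathbb E[M_Q]^*)^{-1}\mathbb E[\psi]$ satisfies $$\theta=P_{1,\mathbb E[M]}^*\,\mathbb E[\psi]=P_{1,\mathbb E[M]}^*\,\psi_{\mathcal S}.$$ Moreover, for almost every sequence $(\omega_n)_{n\ge1}\in\Omega^{\mathbb N^*}$ with respect to the product measure $\mathbb P=\prod_{n\ge1}\mathrm p$, $$\lim_{N\to\infty}\frac1N\sum_{n=1}^N M(\omega_1)\cdots M(\omega_n)=|\psi_{\mathcal S}\rangle\langle\theta|=P_{1,\mathbb E[M]}.$$ -/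

import Mathlib

open MeasureTheory Filter Topology

namespace RRDP

/-- `ℂ^d` with its Euclidean norm and inner product (linear in the second factor). -/
abbrev Vec (d : ℕ) : Type := EuclideanSpace ℂ (Fin d)

/-- Complex `d × d` matrices, as linear operators on `ℂ^d` (with the operator norm topology,
which is the entrywise topology, and its Borel sets). Multiplication is composition. -/
abbrev Op (d : ℕ) : Type := Vec d →L[ℂ] Vec d

/-- Random reduced dynamics operators: measurable random operators `M` on `ℂ^d` which, for all
`ω`, are contractions (operator norm at most one) for one common norm on `ℂ^d` and leave the
Euclidean unit vector `ψS` invariant. A norm is a seminorm that vanishes only at zero. -/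
structure IsRRDO {d : ℕ} {Ω : Type*} [MeasurableSpace Ω] (M : Ω → Op d) (ψS : Vec d) :
    Prop where
  measurable : Measurable M
  contraction : ∃ N : Seminorm ℂ (Vec d),
    (∀ x, N x = 0 → x = 0) ∧ ∀ ω x, N (M ω x) ≤ N x
  invariant : ∀ ω, M ω ψS = ψS
  normalized : ‖ψS‖ = 1

/-- `ℂ^d` is the direct sum of the generalized eigenspace of `f` at `z` and the sum of its
generalized eigenspaces at all other complex numbers. -/
lemma isCompl_genEigenspaces {d : ℕ} (f : Module.End ℂ (Vec d)) (z : ℂ) :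
    IsCompl (f.maxGenEigenspace z) (⨆ w : ℂ, ⨆ _ : w ≠ z, f.maxGenEigenspace w) := by
  refine ⟨f.independent_maxGenEigenspace z, ?_⟩
  rw [codisjoint_iff, eq_top_iff, ← Module.End.iSup_maxGenEigenspace_eq_top f]
  refine iSup_le fun w => ?_
  by_cases h : w = z
  · rw [h]
    exact le_sup_left
  · exact le_sup_of_le_right (le_iSup₂_of_le w h le_rfl)

/-- The spectral (Riesz) projection of `A` for `z`: the projection onto the generalized
eigenspace of `A` at `z` along the sum of all other generalized eigenspaces. -/
noncomputable def spectralProj {d : ℕ} (A : Op d) (z : ℂ) : Op d :=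
  LinearMap.toContinuousLinearMap
    (Submodule.projection _ _ (isCompl_genEigenspaces (A : Vec d →ₗ[ℂ] Vec d) z))

/-- The set of (deterministic) reduced dynamics operators whose only spectral point on the
complex unit circle is `1`, this being a simple eigenvalue. -/
def ME (d : ℕ) : Set (Op d) :=
  {A | (∃ φ : Vec d, IsRRDO (fun _ : Unit => A) φ) ∧
    spectrum ℂ A ∩ Metric.sphere (0 : ℂ) 1 = {1} ∧
    Module.finrank ℂ
      (Module.End.maxGenEigenspace (A : Vec d →ₗ[ℂ] Vec d) 1) = 1}

/-- The rank one operator `|φ⟩⟨χ| : x ↦ ⟨χ, x⟩ φ`. -/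
noncomputable def ketbra {d : ℕ} (φ χ : Vec d) : Op d :=
  InnerProductSpace.rankOne ℂ φ χ

section

variable {d : ℕ} {Ω : Type*} (M : Ω → Op d) (ψS : Vec d)

/-- `ψ(ω) = P₁(ω)^* ψS`, with `P₁(ω)` the spectral projection of `M(ω)` for `1`. -/
noncomputable def psi (ω : Ω) : Vec d :=
  ContinuousLinearMap.adjoint (spectralProj (M ω) 1) ψS

/-- `Q(ω) = 1 - |ψS⟩⟨ψ(ω)|`. -/
noncomputable def Q (ω : Ω) : Op d :=
  1 - ketbra ψS (psi M ψS ω)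

/-- `M_Q(ω) = Q(ω) M(ω) Q(ω)`. -/
noncomputable def MQ (ω : Ω) : Op d :=
  Q M ψS ω * M ω * Q M ψS ω

/-- `θ = (1 - E[M_Q]^*)⁻¹ E[ψ]`. -/
noncomputable def theta [MeasurableSpace Ω] (p : Measure Ω) : Vec d :=
  Ring.inverse (1 - ContinuousLinearMap.adjoint (∫ ω, MQ M ψS ω ∂p)) (∫ ω, psi M ψS ω ∂p)

/-- The process `Ψ_n = M(ω₁) ⋯ M(ω_n)`; the sequence `(ω₁, ω₂, …)` is indexed from `0`,
so that `ω_j` is `ω (j - 1)`. -/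
noncomputable def Psi (n : ℕ) (ω : ℕ → Ω) : Op d :=
  ((List.range n).map fun j => M (ω j)).prod

end

end RRDP

namespace RRDP

/-! Let T = E[M]. All products of the M(ω), and T itself, contract the common norm N, so they are
uniformly bounded and the eigenvalue 1 of each is semisimple.

Almost sure limit: Ψ_{k+1}(1 - T) equals the martingale increment Ψ_k(M(ω_k) - T) plus a telescoping
term (`sum_range_Psi_succ_mul`). Bounded orthogonal increments obey a strong law
(`ae_tendsto_cesaro_Psi_mul_sub`), so the Cesàro means of Ψ multiplied by 1 - T vanish in the limit.
Since 1 - P factors through 1 - T, where P is the spectral projection of T at 1, and since Ψ_n P =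
P, the means converge to P (`IsContraction.tendsto_cesaro`).

The relation Ψ_n P = P requires the fixed space of T to be the line of ψS
(`exists_eq_smul_of_integral_apply_eq`); only here does the hypothesis on `ME` enter. If Tx = x,
equality in Jensen's inequality for N gives N(Aⁿx) = N(x) for every A in the support of the law of
M. Choosing A in `ME` and letting n → ∞ gives N(P_A x) = N(x), with P_A the spectral projection of A
at 1. The vector x - P_A x is again fixed by T, so it has norm N(P_A(x - P_A x)) = 0, and x lies in
the range of P_A.

Formula for θ: M_Q = M - |ψS⟩⟨ψ| (`MQ_eq`), so E[M_Q] is a rank one perturbation of T, and the rest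
is linear algebra. -/

/-- `A` does not increase the seminorm `N`. -/
def IsContraction {d : ℕ} (N : Seminorm ℂ (Vec d)) (A : Op d) : Prop :=
  ∀ x, N (A x) ≤ N x

/-! ### Contractions of a common norm -/

section Contraction

variable {d : ℕ} {N : Seminorm ℂ (Vec d)} {A B : Op d}

lemma IsContraction.one : IsContraction N (1 : Op d) := fun _ => le_rfl

lemma IsContraction.mul (hA : IsContraction N A) (hB : IsContraction N B) :
    IsContraction N (A * B) := fun x => (hA (B x)).trans (hB x)

lemma IsContraction.pow (hA : IsContraction N A) (n : ℕ) : IsContraction N (A ^ n) := by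
  induction n with
  | zero => simpa using IsContraction.one
  | succ n ih => rw [pow_succ]; exact ih.mul hA

lemma continuous_seminorm (N : Seminorm ℂ (Vec d)) : Continuous N := by
  rw [← continuousOn_univ]
  exact ConvexOn.continuousOn isOpen_univ N.convexOn

lemma exists_pos_mul_norm_le_seminorm (hN : ∀ x, N x = 0 → x = 0) :
    ∃ c > 0, ∀ x, c * ‖x‖ ≤ N x := by
  -- The unit sphere is empty exactly when d = 0.
  rcases (Metric.sphere (0 : Vec d) 1).eq_empty_or_nonempty with he | hne
  · refine ⟨1, one_pos, fun x => ?_⟩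
    have hx : x = 0 := by
      by_contra hx
      have : ((‖x‖⁻¹ : ℝ) : ℂ) • x ∈ Metric.sphere (0 : Vec d) 1 := by
        simp [norm_smul, hx]
      rw [he] at this
      exact this
    simp [hx]
  · obtain ⟨y, hy, hmin⟩ := (isCompact_sphere (0 : Vec d) 1).exists_isMinOn hne
      (continuous_seminorm N).continuousOn
    have hy0 : y ≠ 0 := by
      rintro rfl
      simp at hy
    refine ⟨N y, lt_of_le_of_ne (apply_nonneg N y) fun h => hy0 (hN y h.symm), fun x => ?_⟩
    rcases eq_or_ne x 0 with rfl | hx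
    · simp
    have hs : ((‖x‖⁻¹ : ℝ) : ℂ) • x ∈ Metric.sphere (0 : Vec d) 1 := by
      simp [norm_smul, hx]
    have h := hmin hs
    simp only [Set.mem_ofPred_eq, map_smul_eq_mul, Complex.norm_real, norm_inv, norm_norm] at h
    rwa [inv_mul_eq_div, le_div_iff₀ (norm_pos_iff.2 hx)] at h

lemma exists_seminorm_le_mul_norm (N : Seminorm ℂ (Vec d)) :
    ∃ C, 0 ≤ C ∧ ∀ x, N x ≤ C * ‖x‖ := by
  obtain ⟨C, hC, h⟩ := N.bound_of_continuous_normedSpace (continuous_seminorm N)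
  exact ⟨C, hC.le, h⟩

/-- Operators contracting a common norm are uniformly bounded. -/
lemma exists_norm_le_of_isContraction (hN : ∀ x, N x = 0 → x = 0) :
    ∃ K, 0 ≤ K ∧ ∀ A : Op d, IsContraction N A → ‖A‖ ≤ K := by
  obtain ⟨c, hc, hcN⟩ := exists_pos_mul_norm_le_seminorm hN
  obtain ⟨C, hC, hCN⟩ := exists_seminorm_le_mul_norm N
  refine ⟨C / c, by positivity, fun A hA => A.opNorm_le_bound (by positivity) fun x => ?_⟩
  rw [div_mul_eq_mul_div, le_div_iff₀ hc, mul_comm]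
  exact (hcN _).trans ((hA x).trans (hCN x))

end Contraction

/-! ### Spectral projection at 1 and mean ergodic theorem -/

section SpectralProjection

variable {d : ℕ} {N : Seminorm ℂ (Vec d)} {A : Op d}

lemma spectralProj_apply_mem (A : Op d) (z : ℂ) (x : Vec d) :
    spectralProj A z x ∈ Module.End.maxGenEigenspace (A : Vec d →ₗ[ℂ] Vec d) z :=
  Submodule.projection_apply_mem (isCompl_genEigenspaces (A : Vec d →ₗ[ℂ] Vec d) z) x

lemma spectralProj_eq_self {z : ℂ} {x : Vec d}
    (hx : x ∈ Module.End.maxGenEigenspace (A : Vec d →ₗ[ℂ] Vec d) z) : spectralProj A z x = x :=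
  Submodule.projection_apply_of_mem_left
    (isCompl_genEigenspaces (A : Vec d →ₗ[ℂ] Vec d) z) hx

lemma spectralProj_eq_zero_iff {z : ℂ} {x : Vec d} : spectralProj A z x = 0 ↔
    x ∈ ⨆ w : ℂ, ⨆ _ : w ≠ z, Module.End.maxGenEigenspace (A : Vec d →ₗ[ℂ] Vec d) w :=
  Submodule.projection_apply_eq_zero_iff (isCompl_genEigenspaces (A : Vec d →ₗ[ℂ] Vec d) z)

/-- For an operator contracting a norm, the eigenvalue `1` is semisimple. -/
lemma IsContraction.apply_eq_self_of_mem (hN : ∀ x, N x = 0 → x = 0) (hA : IsContraction N A)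
    {x : Vec d} (hx : x ∈ Module.End.maxGenEigenspace (A : Vec d →ₗ[ℂ] Vec d) 1) : A x = x := by
  -- A Jordan block would make Aⁿx grow linearly in n, while N(Aⁿx) stays at most N(x).
  have key : ∀ x, A (A x - x) = A x - x → A x = x := by
    intro x h
    have hpow : ∀ n : ℕ, (A ^ n) x = x + (n : ℂ) • (A x - x) := by
      intro n
      induction n with
      | zero => simp
      | succ n ih =>
        rw [pow_succ', mul_apply_eq_comp, ih, map_add, map_smul, h]
        push_cast
        module
    have hb : ∀ n : ℕ, (n : ℝ) * N (A x - x) ≤ 2 * N x := by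
      intro n
      have h1 : N ((n : ℂ) • (A x - x)) = n * N (A x - x) := by
        rw [map_smul_eq_mul]; simp
      have h2 : (n : ℂ) • (A x - x) = (A ^ n) x - x := by rw [hpow]; abel
      rw [← h1, h2]
      have := map_sub_le_add N ((A ^ n) x) x
      have := hA.pow n x
      linarith
    refine sub_eq_zero.1 (hN _ ?_)
    by_contra h0
    have hpos : 0 < N (A x - x) := lt_of_le_of_ne (apply_nonneg N _) (Ne.symm h0)
    obtain ⟨n, hn⟩ := exists_nat_gt (2 * N x / N (A x - x))
    rw [div_lt_iff₀ hpos] at hn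
    exact absurd (hb n) (not_le.2 hn)
  rw [Module.End.mem_maxGenEigenspace] at hx
  obtain ⟨k, hk⟩ := hx
  induction k generalizing x with
  | zero => simp at hk; simp [hk]
  | succ k ih =>
    apply key
    apply ih
    rw [pow_succ] at hk
    simpa using hk

lemma commute_spectralProj (A : Op d) (z : ℂ) : Commute A (spectralProj A z) := by
  ext1 x
  change A (spectralProj A z x) = spectralProj A z (A x)
  set a : Module.End ℂ (Vec d) := (A : Vec d →ₗ[ℂ] Vec d)
  have hl : A (spectralProj A z x) ∈ Module.End.maxGenEigenspace a z :=
    Module.End.mapsTo_maxGenEigenspace_of_comm (Commute.refl a) z (spectralProj_apply_mem A z x)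
  have hr : A (x - spectralProj A z x) ∈ ⨆ w : ℂ, ⨆ _ : w ≠ z, Module.End.maxGenEigenspace a w := by
    have hmem : x - spectralProj A z x ∈ ⨆ w : ℂ, ⨆ _ : w ≠ z, Module.End.maxGenEigenspace a w := by
      rw [← spectralProj_eq_zero_iff, map_sub, spectralProj_eq_self (spectralProj_apply_mem A z x),
        sub_self]
    have hle : (⨆ w : ℂ, ⨆ _ : w ≠ z, Module.End.maxGenEigenspace a w) ≤
        (⨆ w : ℂ, ⨆ _ : w ≠ z, Module.End.maxGenEigenspace a w).comap a := by
      refine iSup₂_le fun w hw y hy => ?_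
      exact (le_iSup₂_of_le (f := fun w (_ : w ≠ z) => Module.End.maxGenEigenspace a w) w hw le_rfl)
        (Module.End.mapsTo_maxGenEigenspace_of_comm (Commute.refl a) w hy)
    exact hle hmem
  rw [← spectralProj_eq_zero_iff, map_sub, map_sub, spectralProj_eq_self hl] at hr
  exact (sub_eq_zero.1 hr).symm

lemma IsContraction.mul_spectralProj (hN : ∀ x, N x = 0 → x = 0) (hA : IsContraction N A) :
    A * spectralProj A 1 = spectralProj A 1 := by
  ext1 x
  exact hA.apply_eq_self_of_mem hN (spectralProj_apply_mem A 1 x)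

lemma IsContraction.spectralProj_mul (hN : ∀ x, N x = 0 → x = 0) (hA : IsContraction N A) :
    spectralProj A 1 * A = spectralProj A 1 := by
  rw [← (commute_spectralProj A 1).eq, hA.mul_spectralProj hN]

lemma spectralProj_mul_self (A : Op d) (z : ℂ) :
    spectralProj A z * spectralProj A z = spectralProj A z := by
  ext1 x
  exact spectralProj_eq_self (spectralProj_apply_mem A z x)

lemma spectralProj_eq_self_of_apply_eq {x : Vec d} (hx : A x = x) :
    spectralProj A 1 x = x := by
  refine spectralProj_eq_self ?_
  rw [Module.End.mem_maxGenEigenspace]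
  exact ⟨1, by simp [hx]⟩

lemma isUnit_of_injective {A : Op d} (h : ∀ x, A x = 0 → x = 0) : IsUnit A := by
  rw [ContinuousLinearMap.isUnit_iff_bijective]
  have hi : Function.Injective (A : Vec d →ₗ[ℂ] Vec d) :=
    (injective_iff_map_eq_zero _).2 h
  exact ⟨hi, LinearMap.injective_iff_surjective.1 hi⟩

/-- The complementary spectral projection factors through `1 - A`. -/
lemma IsContraction.exists_one_sub_mul_eq (hN : ∀ x, N x = 0 → x = 0)
    (hA : IsContraction N A) : ∃ R : Op d, (1 - A) * R = 1 - spectralProj A 1 := by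
  set P := spectralProj A 1
  have hPA : P * A = P := hA.spectralProj_mul hN
  have hPP : P * P = P := spectralProj_mul_self A 1
  -- On the kernel, applying P gives Px = 0; then Ax = x, hence x = Px = 0.
  have hu : IsUnit (1 - A + P) := by
    refine isUnit_of_injective fun x hx => ?_
    have hPx : P x = 0 := by
      have h : (P * (1 - A + P)) x = 0 := by
        change P ((1 - A + P) x) = 0
        rw [hx, map_zero]
      rwa [mul_add, mul_sub, mul_one, hPA, hPP, sub_self, zero_add] at h
    have hAx : A x = x := by
      have h : x - A x + P x = 0 := hx
      rw [hPx, add_zero] at h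
      exact (sub_eq_zero.1 h).symm
    rw [← spectralProj_eq_self_of_apply_eq hAx]
    exact hPx
  obtain ⟨u, hu⟩ := hu
  refine ⟨(↑u⁻¹ : Op d), ?_⟩
  have h : 1 - A = (1 - P) * u := by
    rw [hu, sub_mul, one_mul, mul_add, mul_sub, mul_one, hPA, hPP]
    abel
  rw [h, mul_assoc, Units.mul_inv, mul_one]

/-- Cesàro means of operators `Φ n` with `Φ n * P = P` converge to the spectral projection `P` of
`A` as soon as the Cesàro means of `Φ n * (1 - A)` vanish in the limit. -/
lemma IsContraction.tendsto_cesaro (hN : ∀ x, N x = 0 → x = 0) (hA : IsContraction N A)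
    {Φ : ℕ → Op d} (hΦ : ∀ n, Φ n * spectralProj A 1 = spectralProj A 1)
    (h : Tendsto (fun n : ℕ => (n : ℂ)⁻¹ • ∑ k ∈ Finset.range n, Φ k * (1 - A)) atTop (𝓝 0)) :
    Tendsto (fun n : ℕ => (n : ℂ)⁻¹ • ∑ k ∈ Finset.range n, Φ k) atTop
      (𝓝 (spectralProj A 1)) := by
  obtain ⟨R, hR⟩ := hA.exists_one_sub_mul_eq hN
  -- Splitting 1 = P + (1 - A)R writes each mean as P plus (mean of Φ(1 - A))R.
  have h2 : Tendsto (fun n : ℕ => spectralProj A 1 +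
      ((n : ℂ)⁻¹ • ∑ k ∈ Finset.range n, Φ k * (1 - A)) * R) atTop (𝓝 (spectralProj A 1)) := by
    have := (h.mul_const R).const_add (spectralProj A 1)
    rwa [zero_mul, add_zero] at this
  refine h2.congr' ?_
  filter_upwards [eventually_gt_atTop 0] with n hn
  have hn' : (n : ℂ) ≠ 0 := by exact_mod_cast hn.ne'
  rw [smul_mul_assoc, Finset.sum_mul]
  simp_rw [mul_assoc, hR, mul_sub, mul_one, hΦ, Finset.sum_sub_distrib, Finset.sum_const,
    Finset.card_range, smul_sub]
  rw [← Nat.cast_smul_eq_nsmul ℂ, smul_smul, inv_mul_cancel₀ hn', one_smul]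
  abel

lemma tendsto_inv_smul_of_norm_le {E : Type*} [NormedAddCommGroup E] [NormedSpace ℂ E]
    {u : ℕ → E} {C : ℝ} (h : ∀ n, ‖u n‖ ≤ C) :
    Tendsto (fun n : ℕ => (n : ℂ)⁻¹ • u n) atTop (𝓝 0) := by
  refine squeeze_zero_norm (a := fun n : ℕ => (n : ℝ)⁻¹ * C) (fun n => ?_) ?_
  · rw [norm_smul, norm_inv, Complex.norm_natCast]
    exact mul_le_mul_of_nonneg_left (h n) (by positivity)
  · simpa using tendsto_inv_atTop_nhds_zero_nat.mul_const C

/-- Mean ergodic theorem for operators contracting a norm. -/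
lemma IsContraction.tendsto_cesaro_pow (hN : ∀ x, N x = 0 → x = 0) (hA : IsContraction N A) :
    Tendsto (fun n : ℕ => (n : ℂ)⁻¹ • ∑ k ∈ Finset.range n, A ^ k) atTop
      (𝓝 (spectralProj A 1)) := by
  obtain ⟨K, hK, hb⟩ := exists_norm_le_of_isContraction hN
  refine hA.tendsto_cesaro hN (fun n => ?_) ?_
  · induction n with
    | zero => rw [pow_zero, one_mul]
    | succ n ih => rw [pow_succ, mul_assoc, hA.mul_spectralProj hN, ih]
  · have hs : ∀ n : ℕ, ∑ k ∈ Finset.range n, A ^ k * (1 - A) = 1 - A ^ n := fun n => by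
      rw [← Finset.sum_mul, geom_sum_mul_neg]
    simp_rw [hs]
    refine tendsto_inv_smul_of_norm_le (C := K + K) fun n => ?_
    exact (norm_sub_le _ _).trans
      (add_le_add (hb _ IsContraction.one) (hb _ (hA.pow n)))

/-- The projection is a limit of averages of contractions, so it inherits their bound. This makes ω
↦ P_{1,M(ω)} bounded, hence integrable once measurable. -/
lemma IsContraction.norm_spectralProj_le (hN : ∀ x, N x = 0 → x = 0) (hA : IsContraction N A)
    {K : ℝ} (hK : ∀ B : Op d, IsContraction N B → ‖B‖ ≤ K) : ‖spectralProj A 1‖ ≤ K := by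
  refine le_of_tendsto (hA.tendsto_cesaro_pow hN).norm ?_
  filter_upwards [eventually_gt_atTop 0] with n hn
  have hn' : (0 : ℝ) < n := by exact_mod_cast hn
  rw [norm_smul, norm_inv, Complex.norm_natCast, inv_mul_le_iff₀ hn']
  refine (norm_sum_le_of_le _ fun k _ => hK _ (hA.pow k)).trans ?_
  simp

/-- The mean ergodic theorem exhibits the projection as a pointwise limit of polynomials in M(ω), so
no continuity of A ↦ P_{1,A} is needed. -/
lemma measurable_spectralProj {Ω : Type*} [MeasurableSpace Ω] {M : Ω → Op d}
    (hN : ∀ x, N x = 0 → x = 0) (hM : Measurable M) (hc : ∀ ω, IsContraction N (M ω)) :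
    Measurable fun ω => spectralProj (M ω) 1 := by
  refine measurable_of_tendsto_metrizable
    (f := fun n ω => (n : ℂ)⁻¹ • ∑ k ∈ Finset.range n, M ω ^ k) (fun n => ?_) ?_
  · exact (Finset.measurable_fun_sum _ fun k _ => hM.pow_const k).const_smul (n : ℂ)⁻¹
  · exact tendsto_pi_nhds.2 fun ω => (hc ω).tendsto_cesaro_pow hN

/-- If `1` is the only peripheral eigenvalue, the powers converge to the spectral projection. -/
lemma IsContraction.tendsto_pow (hN : ∀ x, N x = 0 → x = 0) (hA : IsContraction N A)
    (hs : spectrum ℂ A ∩ Metric.sphere (0 : ℂ) 1 ⊆ {1}) :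
    Tendsto (fun n => A ^ n) atTop (𝓝 (spectralProj A 1)) := by
  set P := spectralProj A 1 with hP
  have hPA : P * A = P := hA.spectralProj_mul hN
  have hAP : A * P = P := hA.mul_spectralProj hN
  have hPP : P * P = P := spectralProj_mul_self A 1
  -- The exponent is shifted because the identity would read 1 = 1 - P at exponent 0.
  have hpow : ∀ n, (A - P) ^ (n + 1) = A ^ (n + 1) - P := by
    intro n
    induction n with
    | zero => simp
    | succ n ih =>
      have hAnP : A ^ (n + 1) * P = P := by
        clear ih
        induction n with
        | zero => simpa using hAP
        | succ n ih => rw [pow_succ, mul_assoc, hAP, ih]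
      rw [pow_succ, ih, sub_mul, mul_sub, mul_sub, hPA, hPP, hAnP, ← pow_succ]
      abel
  rcases subsingleton_or_nontrivial (Op d) with hsub | hnt
  · exact tendsto_const_nhds.congr fun n => Subsingleton.elim _ _
  -- An eigenvector of A - P with |z| ≥ 1 is killed by P, so it is an eigenvector of A. Contraction
  -- forces |z| = 1, hence z = 1, and then the vector lies in the range of P as well.
  have hlt : spectralRadius ℂ (A - P) < ((1 : NNReal) : ENNReal) := by
    refine spectrum.spectralRadius_lt_of_forall_lt _ fun z hz => ?_
    by_contra hz1
    rw [not_lt] at hz1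
    have hz1 : 1 ≤ ‖z‖ := hz1
    have hninj : ¬ ∀ x, (algebraMap ℂ (Op d) z - (A - P)) x = 0 → x = 0 := fun h =>
      hz (isUnit_of_injective h)
    push Not at hninj
    obtain ⟨x, hx, hx0⟩ := hninj
    have hx' : A x - P x = z • x := by
      rw [sub_apply, Algebra.algebraMap_eq_smul_one,
        smul_apply, one_apply_eq_self, sub_eq_zero] at hx
      exact hx.symm
    have hz0 : z ≠ 0 := by
      rintro rfl
      simp at hz1
      linarith
    have hPx : P x = 0 := by
      have h := congrArg P hx'
      rw [map_sub, map_smul] at h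
      have h1 : P (A x) = P x := DFunLike.congr_fun hPA x
      have h2 : P (P x) = P x := DFunLike.congr_fun hPP x
      rw [h1, h2, sub_self] at h
      exact (smul_eq_zero.1 h.symm).resolve_left hz0
    rw [hPx, sub_zero] at hx'
    have hNx : 0 < N x := lt_of_le_of_ne (apply_nonneg N x) fun h => hx0 (hN x h.symm)
    have hle : ‖z‖ ≤ 1 := by
      have := hA x
      rw [hx', map_smul_eq_mul] at this
      exact (mul_le_iff_le_one_left hNx).1 this
    have hzs : z ∈ spectrum ℂ A := by
      intro hu
      replace hu := ContinuousLinearMap.isUnit_iff_bijective.1 hu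
      refine hx0 (hu.1 ?_)
      rw [map_zero, sub_apply, Algebra.algebraMap_eq_smul_one,
        smul_apply, one_apply_eq_self, hx', sub_self]
    have hz : z = 1 := hs ⟨hzs, by simpa using le_antisymm hle hz1⟩
    rw [hz, one_smul] at hx'
    exact hx0 ((spectralProj_eq_self_of_apply_eq hx').symm.trans hPx)
  have hto : Tendsto (fun n => (A - P) ^ n) atTop (𝓝 0) := by
    obtain ⟨r, hr, hr1⟩ := ENNReal.lt_iff_exists_nnreal_btwn.1 hlt
    have hev := (spectrum.pow_nnnorm_pow_one_div_tendsto_nhds_spectralRadius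
      (A - P)).eventually_lt_const hr
    refine squeeze_zero_norm' (a := fun n => (r : ℝ) ^ n) ?_
      (tendsto_pow_atTop_nhds_zero_of_lt_one r.2 (by exact_mod_cast hr1))
    filter_upwards [hev, eventually_gt_atTop 0] with n hn hn0
    have h := ENNReal.rpow_le_rpow hn.le (Nat.cast_nonneg n)
    rw [← ENNReal.rpow_mul, one_div, inv_mul_cancel₀ (by exact_mod_cast hn0.ne'),
      ENNReal.rpow_one, ENNReal.rpow_natCast] at h
    exact_mod_cast h
  have h1 := (hto.comp (tendsto_add_atTop_nat 1)).add_const P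
  rw [zero_add] at h1
  refine (tendsto_add_atTop_iff_nat 1).1 (h1.congr fun n => ?_)
  simp [hpow]

end SpectralProjection

/-! ### Strong law for bounded orthogonal increments -/

section LawOfLargeNumbers

/-- If the increments of `s` are bounded, then convergence of `‖s n‖ / n` to zero along the squares
implies convergence along all integers. -/
lemma tendsto_inv_smul_of_tendsto_squares {E : Type*} [NormedAddCommGroup E] [NormedSpace ℂ E]
    {s : ℕ → E} {C : ℝ} (hC : ∀ n, ‖s (n + 1) - s n‖ ≤ C)
    (h : Tendsto (fun k : ℕ => ‖s (k ^ 2)‖ / (k : ℝ) ^ 2) atTop (𝓝 0)) :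
    Tendsto (fun n : ℕ => (n : ℂ)⁻¹ • s n) atTop (𝓝 0) := by
  have hC0 : 0 ≤ C := (norm_nonneg _).trans (hC 0)
  have hinc : ∀ m j : ℕ, ‖s (m + j)‖ ≤ ‖s m‖ + j * C := by
    intro m j
    induction j with
    | zero => simp
    | succ j ih =>
      have h1 : ‖s (m + j + 1)‖ ≤ ‖s (m + j)‖ + ‖s (m + j + 1) - s (m + j)‖ := by
        simpa using norm_add_le (s (m + j)) (s (m + j + 1) - s (m + j))
      have h2 := hC (m + j)
      rw [← add_assoc]
      push_cast
      linarith
  have hsq : Tendsto Nat.sqrt atTop atTop := by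
    refine tendsto_atTop.2 fun b => ?_
    filter_upwards [eventually_ge_atTop (b * b)] with n hn using Nat.le_sqrt.2 hn
  have hlim : Tendsto (fun k : ℕ => ‖s (k ^ 2)‖ / (k : ℝ) ^ 2 + 2 * C * (k : ℝ)⁻¹) atTop (𝓝 0) := by
    simpa using h.add (tendsto_inv_atTop_nhds_zero_nat.const_mul (2 * C))
  refine squeeze_zero_norm' ?_ (hlim.comp hsq)
  filter_upwards [eventually_gt_atTop 0] with n hn
  set k := Nat.sqrt n
  have hk : 0 < k := Nat.sqrt_pos.2 hn
  have hkn : k ^ 2 ≤ n := Nat.sqrt_le' n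
  -- The distance to the preceding square is at most 2k, so the increments contribute at most 2kC,
  -- negligible against k².
  have hnk : n - k ^ 2 ≤ 2 * k := by
    have : n ≤ k * k + k + k := Nat.sqrt_le_add n
    rw [sq]
    omega
  have hs : ‖s n‖ ≤ ‖s (k ^ 2)‖ + 2 * k * C := by
    have h1 := hinc (k ^ 2) (n - k ^ 2)
    rw [Nat.add_sub_cancel' hkn] at h1
    have h2 : ((n - k ^ 2 : ℕ) : ℝ) ≤ 2 * k := by exact_mod_cast hnk
    exact h1.trans (by gcongr)
  have hk' : (0 : ℝ) < k := by exact_mod_cast hk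
  have hkn' : (k : ℝ) ^ 2 ≤ n := by exact_mod_cast hkn
  rw [norm_smul, norm_inv, Complex.norm_natCast, inv_mul_eq_div]
  calc ‖s n‖ / n ≤ (‖s (k ^ 2)‖ + 2 * k * C) / n := by gcongr
    _ ≤ (‖s (k ^ 2)‖ + 2 * k * C) / (k : ℝ) ^ 2 := by gcongr
    _ = ‖s (k ^ 2)‖ / (k : ℝ) ^ 2 + 2 * C * (k : ℝ)⁻¹ := by field_simp

variable {Ω : Type*} [MeasurableSpace Ω] {P : Measure Ω} [IsProbabilityMeasure P]

/-- Second moment of a sum of bounded functions, each orthogonal to the sum of the previous ones. -/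
lemma integral_norm_sum_sq_le {f : ℕ → Ω → ℂ} {C : ℝ} (hm : ∀ n, Measurable (f n))
    (hb : ∀ n ω, ‖f n ω‖ ≤ C)
    (ho : ∀ n, ∫ ω, star (∑ k ∈ Finset.range n, f k ω) * f n ω ∂P = 0) (n : ℕ) :
    ∫ ω, ‖∑ k ∈ Finset.range n, f k ω‖ ^ 2 ∂P ≤ n * C ^ 2 := by
  have hSm : ∀ n, Measurable fun ω => ∑ k ∈ Finset.range n, f k ω := fun n =>
    Finset.measurable_fun_sum _ fun k _ => hm k
  have hSb : ∀ n ω, ‖∑ k ∈ Finset.range n, f k ω‖ ≤ n * C := fun n ω => by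
    simpa using norm_sum_le_of_le (Finset.range n) fun k _ => hb k ω
  induction n with
  | zero => simp
  | succ n ih =>
    have hexp : ∀ ω, ‖∑ k ∈ Finset.range (n + 1), f k ω‖ ^ 2 =
        ‖∑ k ∈ Finset.range n, f k ω‖ ^ 2 +
          2 * (star (∑ k ∈ Finset.range n, f k ω) * f n ω).re + ‖f n ω‖ ^ 2 := fun ω => by
      rw [Finset.sum_range_succ, Complex.sq_norm, Complex.sq_norm, Complex.sq_norm,
        Complex.normSq_add]
      have : (∑ k ∈ Finset.range n, f k ω) * (starRingEnd ℂ) (f n ω) =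
          star (star (∑ k ∈ Finset.range n, f k ω) * f n ω) := by
        rw [star_mul', star_star]; rfl
      rw [this, Complex.star_def, Complex.conj_re]
      ring
    have i1 : Integrable (fun ω => ‖∑ k ∈ Finset.range n, f k ω‖ ^ 2) P := by
      refine Integrable.of_bound ((hSm n).norm.pow_const 2).aestronglyMeasurable ((n * C) ^ 2)
        (ae_of_all _ fun ω => ?_)
      rw [norm_pow, norm_norm]
      gcongr
      exact hSb n ω
    have i2 : Integrable (fun ω => star (∑ k ∈ Finset.range n, f k ω) * f n ω) P := by
      refine Integrable.of_bound ((continuous_star.measurable.comp (hSm n)).mul (hm n)).aestronglyMeasurable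
        ((n * C) * C)
        (ae_of_all _ fun ω => ?_)
      rw [norm_mul, norm_star]
      exact mul_le_mul (hSb n ω) (hb n ω) (norm_nonneg _) ((norm_nonneg _).trans (hSb n ω))
    have hbsq : ∀ ω, ‖f n ω‖ ^ 2 ≤ C ^ 2 := fun ω => by
      gcongr
      exact hb n ω
    have i3 : Integrable (fun ω => ‖f n ω‖ ^ 2) P := by
      refine Integrable.of_bound ((hm n).norm.pow_const 2).aestronglyMeasurable (C ^ 2)
        (ae_of_all _ fun ω => ?_)
      rw [norm_pow, norm_norm]
      exact hbsq ω
    have h3 : ∫ ω, ‖f n ω‖ ^ 2 ∂P ≤ C ^ 2 := by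
      simpa using integral_mono i3 (integrable_const (C ^ 2)) hbsq
    have h2 : ∫ ω, (star (∑ k ∈ Finset.range n, f k ω) * f n ω).re ∂P = 0 := by
      have := integral_re i2
      rw [ho n] at this
      simpa using this
    have i2' : Integrable
        (fun ω => 2 * (star (∑ k ∈ Finset.range n, f k ω) * f n ω).re) P := i2.re.const_mul 2
    have i12 : Integrable (fun ω => ‖∑ k ∈ Finset.range n, f k ω‖ ^ 2 +
        2 * (star (∑ k ∈ Finset.range n, f k ω) * f n ω).re) P := i1.add i2'
    simp_rw [hexp]
    rw [integral_add i12 i3, integral_add i1 i2', integral_const_mul, h2]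
    push_cast
    linarith

/-- Strong law of large numbers for bounded orthogonal increments. -/
lemma ae_tendsto_cesaro_of_orthogonal {f : ℕ → Ω → ℂ} {C : ℝ} (hm : ∀ n, Measurable (f n))
    (hb : ∀ n ω, ‖f n ω‖ ≤ C)
    (ho : ∀ n, ∫ ω, star (∑ k ∈ Finset.range n, f k ω) * f n ω ∂P = 0) :
    ∀ᵐ ω ∂P, Tendsto (fun n : ℕ => (n : ℂ)⁻¹ • ∑ k ∈ Finset.range n, f k ω) atTop (𝓝 0) := by
  set S : ℕ → Ω → ℂ := fun n ω => ∑ k ∈ Finset.range n, f k ω with hS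
  have hSm : ∀ n, Measurable (S n) := fun n => Finset.measurable_fun_sum _ fun k _ => hm k
  have hSb : ∀ n ω, ‖S n ω‖ ≤ n * C := fun n ω => by
    simpa using norm_sum_le_of_le (Finset.range n) fun k _ => hb k ω
  set g : ℕ → Ω → ℝ := fun k ω => (‖S (k ^ 2) ω‖ / (k : ℝ) ^ 2) ^ 2 with hg
  have hgm : ∀ k, Measurable (g k) := fun k =>
    ((hSm (k ^ 2)).norm.div_const _).pow_const 2
  have hgi : ∀ k, Integrable (g k) P := fun k => by
    refine Integrable.of_bound (hgm k).aestronglyMeasurable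
      ((((k ^ 2 : ℕ) : ℝ) * C / (k : ℝ) ^ 2) ^ 2) (ae_of_all _ fun ω => ?_)
    rw [Real.norm_of_nonneg (by positivity)]
    simp only [hg]
    gcongr
    exact hSb _ ω
  -- The second moment of S at k² is at most k²C²; division by k⁴ leaves a summable bound. At k = 0
  -- both sides are 0, since division by zero gives 0.
  have hgint : ∀ k, ∫ ω, g k ω ∂P ≤ C ^ 2 * (1 / (k : ℝ) ^ 2) := fun k => by
    rcases Nat.eq_zero_or_pos k with rfl | hk
    · simp [hg]
    have hk' : (0 : ℝ) < k := by exact_mod_cast hk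
    simp only [hg, div_pow]
    rw [integral_div, div_le_iff₀ (by positivity)]
    refine (integral_norm_sum_sq_le hm hb ho (k ^ 2)).trans (le_of_eq ?_)
    push_cast
    field_simp
  have hsum : ∑' k : ℕ, ENNReal.ofReal (C ^ 2 * (1 / (k : ℝ) ^ 2)) ≠ ⊤ :=
    ((Real.summable_one_div_nat_pow.2 one_lt_two).mul_left (C ^ 2)).tsum_ofReal_ne_top
  -- The series of the g k has finite expectation, so it converges almost surely and its terms tend
  -- to 0.
  have hlint : ∫⁻ ω, ∑' k, ENNReal.ofReal (g k ω) ∂P ≠ ⊤ := by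
    rw [lintegral_tsum fun k => (hgm k).ennreal_ofReal.aemeasurable]
    refine ne_top_of_le_ne_top hsum (ENNReal.tsum_le_tsum fun k => ?_)
    rw [← ofReal_integral_eq_lintegral_ofReal (hgi k) (ae_of_all _ fun ω => by positivity)]
    exact ENNReal.ofReal_le_ofReal (hgint k)
  filter_upwards [ae_lt_top (Measurable.tsum fun k => (hgm k).ennreal_ofReal) hlint] with ω hω
  refine tendsto_inv_smul_of_tendsto_squares (C := C) (fun n => ?_) ?_
  · rw [Finset.sum_range_succ, add_sub_cancel_left]
    exact hb n ω
  · have h1 := ENNReal.tendsto_atTop_zero_of_tsum_ne_top hω.ne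
    have h2 : Tendsto (fun k => g k ω) atTop (𝓝 0) := by
      have := (ENNReal.tendsto_toReal ENNReal.zero_ne_top).comp h1
      refine this.congr fun k => ?_
      simp only [Function.comp_apply]
      exact ENNReal.toReal_ofReal (by positivity)
    have h3 := (Real.continuous_sqrt.tendsto 0).comp h2
    rw [Real.sqrt_zero] at h3
    refine h3.congr fun k => ?_
    exact Real.sqrt_sq (by positivity)

end LawOfLargeNumbers

/-! ### Matrix entries -/

section Coordinates

variable {d : ℕ}

lemma measurable_coord (x : Vec d) (i : Fin d) : Measurable fun A : Op d => A x i :=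
  (((EuclideanSpace.proj i : Vec d →L[ℂ] ℂ).comp
    (ContinuousLinearMap.apply ℂ (Vec d) x)).continuous).measurable

lemma apply_coord_eq_sum (A : Op d) (v : Vec d) (i : Fin d) :
    A v i = ∑ k, A (EuclideanSpace.single k 1) i * v k := by
  conv_lhs => rw [← (EuclideanSpace.basisFun (Fin d) ℂ).sum_repr v]
  simp [map_sum, mul_comm]

lemma norm_apply_coord_le (A : Op d) (x : Vec d) (i : Fin d) : ‖A x i‖ ≤ ‖A‖ * ‖x‖ :=
  (PiLp.norm_apply_le (A x) i).trans (A.le_opNorm x)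

/-- Operators converge to zero when all their matrix entries do. -/
lemma tendsto_zero_of_coord {u : ℕ → Op d}
    (h : ∀ i j : Fin d, Tendsto (fun n => u n (EuclideanSpace.single j 1) i) atTop (𝓝 0)) :
    Tendsto u atTop (𝓝 0) := by
  have hrep : ∀ A : Op d, A = ∑ i, ∑ j, (A (EuclideanSpace.single j 1) i) •
      ketbra (EuclideanSpace.single i 1) (EuclideanSpace.single j 1) := by
    intro A
    ext x i
    rw [apply_coord_eq_sum A x i]
    simp [ketbra, InnerProductSpace.rankOne_apply,
      EuclideanSpace.inner_single_left, Pi.single_apply]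
  have h0 : Tendsto (fun n => ∑ i, ∑ j, (u n (EuclideanSpace.single j 1) i) •
      ketbra (EuclideanSpace.single i (1 : ℂ)) (EuclideanSpace.single j (1 : ℂ))) atTop
      (𝓝 (∑ i : Fin d, ∑ j : Fin d, (0 : ℂ) •
        ketbra (EuclideanSpace.single i (1 : ℂ)) (EuclideanSpace.single j (1 : ℂ)))) :=
    tendsto_finsetSum _ fun i _ => tendsto_finsetSum _ fun j _ => (h i j).smul_const _
  rw [show (∑ i : Fin d, ∑ j : Fin d, (0 : ℂ) • ketbra (EuclideanSpace.single i (1 : ℂ))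
    (EuclideanSpace.single j (1 : ℂ))) = 0 from
    Finset.sum_eq_zero fun _ _ => Finset.sum_eq_zero fun _ _ => zero_smul ℂ (_ : Op d)] at h0
  exact h0.congr fun n => (hrep (u n)).symm

end Coordinates

/-! ### Algebra of the products Ψ_n -/

section RandomProducts

variable {Ω : Type*} {d : ℕ} {M : Ω → Op d}

lemma Psi_succ (M : Ω → Op d) (n : ℕ) (ω : ℕ → Ω) : Psi M (n + 1) ω = Psi M n ω * M (ω n) := by
  simp [Psi, List.range_succ]

lemma Psi_zero (M : Ω → Op d) (ω : ℕ → Ω) : Psi M 0 ω = 1 := rfl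

lemma Psi_congr (M : Ω → Op d) {n : ℕ} {ω ω' : ℕ → Ω} (h : ∀ j < n, ω j = ω' j) :
    Psi M n ω = Psi M n ω' := by
  unfold Psi
  congr 1
  refine List.map_congr_left fun j hj => ?_
  rw [h j (List.mem_range.1 hj)]

lemma isContraction_Psi {N : Seminorm ℂ (Vec d)} (hc : ∀ ω, IsContraction N (M ω)) (n : ℕ)
    (ω : ℕ → Ω) : IsContraction N (Psi M n ω) := by
  induction n with
  | zero => exact IsContraction.one
  | succ n ih => rw [Psi_succ]; exact ih.mul (hc _)

end RandomProducts

/-! ### Independence and the martingale part -/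

section Product

variable {Ω : Type*} [MeasurableSpace Ω] (p : Measure Ω) [IsProbabilityMeasure p]

/-- Under the product measure, a function of the coordinates before `n` is independent of a
function of the coordinate `n`. -/
lemma integral_mul_eval_infinitePi {n : ℕ} {G : (ℕ → Ω) → ℂ} {H : Ω → ℂ} (hG : Measurable G)
    (hH : Measurable H) (hGn : ∀ ω ω' : ℕ → Ω, (∀ j < n, ω j = ω' j) → G ω = G ω') :
    ∫ ω, G ω * H (ω n) ∂(Measure.infinitePi fun _ : ℕ => p) =
      (∫ ω, G ω ∂(Measure.infinitePi fun _ : ℕ => p)) * ∫ x, H x ∂p := by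
  obtain ⟨x₀⟩ := p.nonempty_of_neZero
  have hind : ProbabilityTheory.iIndepFun (fun (i : ℕ) (ω : ℕ → Ω) => ω i)
      (Measure.infinitePi fun _ : ℕ => p) :=
    ProbabilityTheory.iIndepFun_infinitePi (P := fun _ : ℕ => p) (X := fun _ => id)
      fun _ => measurable_id
  have h1 := hind.indepFun_finset (Finset.range n) {n} (by simp) fun i => measurable_pi_apply i
  -- Pads the first n coordinates to a full sequence; G does not see the padding value x₀.
  let ext : (Finset.range n → Ω) → ℕ → Ω := fun y j =>
    if h : j ∈ Finset.range n then y ⟨j, h⟩ else x₀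
  have hext : Measurable ext := by
    refine measurable_pi_lambda _ fun j => ?_
    by_cases h : j ∈ Finset.range n
    · simp only [ext, dif_pos h]
      exact measurable_pi_apply _
    · simp only [ext, dif_neg h]
      exact measurable_const
  have h2 := h1.comp (φ := fun y => G (ext y))
    (ψ := fun y : ({n} : Finset ℕ) → Ω => H (y ⟨n, Finset.mem_singleton_self n⟩))
    (hG.comp hext) (hH.comp (measurable_pi_apply _))
  have hGe : ((fun y => G (ext y)) ∘ fun (a : ℕ → Ω) (i : Finset.range n) => a i) = G := by
    funext ω
    refine hGn _ _ fun j hj => ?_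
    simp [ext, hj]
  rw [hGe] at h2
  have h3 := h2.integral_mul_eq_mul_integral hG.aestronglyMeasurable
    (hH.comp (measurable_pi_apply n)).aestronglyMeasurable
  refine h3.trans (congrArg _ ?_)
  conv_rhs => rw [← Measure.infinitePi_map_eval (fun _ : ℕ => p) n]
  rw [integral_map (measurable_pi_apply n).aemeasurable hH.aestronglyMeasurable]
  rfl

variable {d : ℕ} {M : Ω → Op d}

lemma measurable_Psi (hM : Measurable M) (n : ℕ) : Measurable (Psi M n) := by
  induction n with
  | zero => exact measurable_const
  | succ n ih =>
    have : Psi M (n + 1) = fun ω => Psi M n ω * M (ω n) := funext fun ω => Psi_succ M n ω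
    rw [this]
    exact ih.mul (hM.comp (measurable_pi_apply n))

/-- The Cesàro means of the martingale increments `Ψ n * (M (ω n) - E[M])` vanish almost surely. -/
lemma ae_tendsto_cesaro_Psi_mul_sub (hM : Measurable M) {K : ℝ} (hK : ∀ ω, ‖M ω‖ ≤ K)
    (hΨ : ∀ n ω, ‖Psi M n ω‖ ≤ K) :
    ∀ᵐ ω ∂(Measure.infinitePi fun _ : ℕ => p),
      Tendsto (fun n : ℕ => (n : ℂ)⁻¹ • ∑ k ∈ Finset.range n,
        Psi M k ω * (M (ω k) - ∫ x, M x ∂p)) atTop (𝓝 0) := by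
  obtain ⟨x₀⟩ := p.nonempty_of_neZero
  have hK0 : 0 ≤ K := (norm_nonneg _).trans (hK x₀)
  set T := ∫ x, M x ∂p
  have hMi : Integrable M p := .of_bound hM.aestronglyMeasurable K (ae_of_all _ hK)
  have hsub : Measurable fun x => M x - T := hM.sub_const T
  have hT : ∀ x, ‖M x - T‖ ≤ K + ‖T‖ := fun x => (norm_sub_le _ _).trans (by gcongr; exact hK x)
  set D : ℕ → (ℕ → Ω) → Op d := fun n ω => Psi M n ω * (M (ω n) - T) with hD
  have hDm : ∀ n, Measurable (D n) := fun n =>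
    (measurable_Psi hM n).mul (hsub.comp (measurable_pi_apply n))
  have hDb : ∀ n ω, ‖D n ω‖ ≤ K * (K + ‖T‖) := fun n ω =>
    (norm_mul_le _ _).trans (mul_le_mul (hΨ n ω) (hT _) (norm_nonneg _) hK0)
  have key : ∀ i j : Fin d, ∀ᵐ ω ∂(Measure.infinitePi fun _ : ℕ => p),
      Tendsto (fun n : ℕ => (n : ℂ)⁻¹ • ∑ k ∈ Finset.range n,
        D k ω (EuclideanSpace.single j 1) i) atTop (𝓝 0) := by
    intro i j
    set e : Vec d := EuclideanSpace.single j 1 with he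
    have hnorm : ‖e‖ = 1 := by simp [he]
    have hfm : ∀ n, Measurable fun ω => D n ω e i := fun n => (measurable_coord e i).comp (hDm n)
    have hfb : ∀ n ω, ‖D n ω e i‖ ≤ K * (K + ‖T‖) := fun n ω => by
      refine (norm_apply_coord_le _ _ _).trans ?_
      rw [hnorm, mul_one]
      exact hDb n ω
    refine ae_tendsto_cesaro_of_orthogonal hfm hfb fun n => ?_
    -- Expanding the matrix product entrywise turns each summand into a scalar function of the past
    -- times a centred scalar function of ω n, so independence applies despite noncommutativity.
    have hexp : ∀ ω, star (∑ k ∈ Finset.range n, D k ω e i) * D n ω e i =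
        ∑ l, (star (∑ k ∈ Finset.range n, D k ω e i) *
          Psi M n ω (EuclideanSpace.single l 1) i) * (M (ω n) - T) e l := fun ω => by
      have : D n ω e i = Psi M n ω ((M (ω n) - T) e) i := rfl
      rw [this, apply_coord_eq_sum, Finset.mul_sum]
      simp_rw [mul_assoc]
    have hSm : Measurable fun ω => star (∑ k ∈ Finset.range n, D k ω e i) :=
      continuous_star.measurable.comp (Finset.measurable_fun_sum _ fun k _ => hfm k)
    have hGm : ∀ l : Fin d, Measurable fun ω => star (∑ k ∈ Finset.range n, D k ω e i) *
          Psi M n ω (EuclideanSpace.single l 1) i := fun l =>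
      hSm.mul ((measurable_coord _ i).comp (measurable_Psi hM n))
    have hHm : ∀ l : Fin d, Measurable fun x => (M x - T) e l := fun l =>
      (measurable_coord e l).comp hsub
    simp_rw [hexp]
    rw [integral_finsetSum]
    · refine Finset.sum_eq_zero fun l _ => ?_
      rw [integral_mul_eval_infinitePi p (hGm l) (hHm l)]
      · have hzero : ∫ x, (M x - T) e l ∂p = 0 := by
          have hLi := ((EuclideanSpace.proj l : Vec d →L[ℂ] ℂ).comp
            (ContinuousLinearMap.apply ℂ (Vec d) e)).integral_comp_comm
            (hMi.sub (integrable_const T))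
          have h0 : ∫ x, (M - fun _ : Ω => T : Ω → Op d) x ∂p = 0 := by
            simp only [Pi.sub_apply]
            rw [integral_sub hMi (integrable_const T)]
            simp [T]
          rw [h0, map_zero] at hLi
          exact hLi
        rw [hzero, mul_zero]
      · intro ω ω' h
        have hDc : ∀ k ∈ Finset.range n, D k ω e i = D k ω' e i := fun k hk => by
          have hk' := Finset.mem_range.1 hk
          simp only [hD]
          rw [Psi_congr M fun j hj => h j (hj.trans hk'), h k hk']
        rw [Finset.sum_congr rfl hDc, Psi_congr M h]
    · intro l _
      refine Integrable.of_bound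
        ((hGm l).mul ((hHm l).comp (measurable_pi_apply n))).aestronglyMeasurable
        ((n * (K * (K + ‖T‖))) * K * (K + ‖T‖)) (ae_of_all _ fun ω => ?_)
      rw [norm_mul, norm_mul, norm_star]
      have b1 : ‖∑ k ∈ Finset.range n, D k ω e i‖ ≤ n * (K * (K + ‖T‖)) := by
        simpa using norm_sum_le_of_le (Finset.range n) fun k _ => hfb k ω
      have b2 : ‖Psi M n ω (EuclideanSpace.single l 1) i‖ ≤ K := by
        refine (norm_apply_coord_le _ _ _).trans ?_
        simpa using hΨ n ω
      have b3 : ‖(M (ω n) - T) e l‖ ≤ K + ‖T‖ := by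
        refine (norm_apply_coord_le _ _ _).trans ?_
        rw [hnorm, mul_one]
        exact hT _
      gcongr
  have hall : ∀ᵐ ω ∂(Measure.infinitePi fun _ : ℕ => p), ∀ i j : Fin d,
      Tendsto (fun n : ℕ => (n : ℂ)⁻¹ • ∑ k ∈ Finset.range n,
        D k ω (EuclideanSpace.single j 1) i) atTop (𝓝 0) :=
    ae_all_iff.2 fun i => ae_all_iff.2 fun j => key i j
  filter_upwards [hall] with ω hω
  refine tendsto_zero_of_coord fun i j => (hω i j).congr fun n => ?_
  simp [hD]

end Product

open scoped InnerProductSpace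

/-! ### Rank one operators -/

section RankOne

variable {d : ℕ}

lemma ketbra_apply (φ χ x : Vec d) : ketbra φ χ x = ⟪χ, x⟫_ℂ • φ :=
  InnerProductSpace.rankOne_apply φ χ x

lemma ketbra_adjoint (φ χ : Vec d) (A : Op d) :
    ketbra φ (ContinuousLinearMap.adjoint A χ) = ketbra φ χ * A := by
  ext1 x
  change _ = ketbra φ χ (A x)
  rw [ketbra_apply, ketbra_apply, ContinuousLinearMap.adjoint_inner_left]

end RankOne

/-! ### Fixed vectors of the mean operator -/

section Mean

variable {d : ℕ} {Ω : Type*} [MeasurableSpace Ω] {p : Measure Ω}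
  {M : Ω → Op d} {N : Seminorm ℂ (Vec d)} {ψS : Vec d}

lemma integrable_seminorm_apply [IsFiniteMeasure p] (hM : Measurable M)
    (hc : ∀ ω, IsContraction N (M ω)) {B : Op d} (hB : IsContraction N B) (x : Vec d) :
    Integrable (fun ω => N (B (M ω x))) p := by
  have hcont : Continuous fun A : Op d => N (B (A x)) :=
    (continuous_seminorm N).comp (B.continuous.comp
      (ContinuousLinearMap.apply ℂ (Vec d) x).continuous)
  refine Integrable.of_bound (hcont.measurable.comp hM).aestronglyMeasurable (N x)
    (ae_of_all _ fun ω => ?_)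
  rw [Real.norm_of_nonneg (apply_nonneg N _)]
  exact (hB _).trans (hc ω x)

variable [IsProbabilityMeasure p]

/-- Jensen's inequality for the convex function N. The extra contraction B lets the equality case be
iterated along powers of an operator. -/
lemma seminorm_apply_integral_le (hM : Measurable M) (hMi : Integrable M p)
    (hc : ∀ ω, IsContraction N (M ω)) {B : Op d} (hB : IsContraction N B) (x : Vec d) :
    N (B ((∫ ω, M ω ∂p) x)) ≤ ∫ ω, N (B (M ω x)) ∂p := by
  set L : Op d →L[ℂ] Vec d := B.comp (ContinuousLinearMap.apply ℂ (Vec d) x)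
  have hL : ∀ A : Op d, L A = B (A x) := fun _ => rfl
  have h := ConvexOn.map_integral_le (μ := p) (f := fun ω => L (M ω)) (g := N) N.convexOn
    (continuous_seminorm N).continuousOn isClosed_univ (ae_of_all _ fun _ => Set.mem_univ _)
    (L.integrable_comp hMi) (integrable_seminorm_apply hM hc hB x)
  rwa [L.integral_comp_comm hMi] at h

lemma isContraction_integral (hM : Measurable M) (hMi : Integrable M p)
    (hc : ∀ ω, IsContraction N (M ω)) : IsContraction N (∫ ω, M ω ∂p) := fun x => by
  refine (seminorm_apply_integral_le hM hMi hc IsContraction.one x).trans ?_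
  have := integral_mono (integrable_seminorm_apply (p := p) hM hc IsContraction.one x)
    (integrable_const (N x)) fun ω => hc ω x
  simpa using this

/-- If `y` is fixed by the mean of `M`, then operators in the support of the law of `M` preserve
the norm of `y`, even after composition with a contraction preserving it. -/
lemma seminorm_apply_eq_of_mem_support (hM : Measurable M) (hMi : Integrable M p)
    (hc : ∀ ω, IsContraction N (M ω)) {y : Vec d} (hy : (∫ ω, M ω ∂p) y = y) {B : Op d}
    (hB : IsContraction N B) (hBy : N (B y) = N y) {A : Op d} (hA : A ∈ (p.map M).support) :
    N (B (A y)) = N y := by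
  have hcont : Continuous fun A : Op d => N (B (A y)) :=
    (continuous_seminorm N).comp (B.continuous.comp
      (ContinuousLinearMap.apply ℂ (Vec d) y).continuous)
  have hclosed : IsClosed {A : Op d | N (B (A y)) = N y} := isClosed_eq hcont continuous_const
  refine Measure.support_subset_of_isClosed (μ := p.map M) hclosed ?_ hA
  change ∀ᵐ A ∂(p.map M), N (B (A y)) = N y
  rw [ae_map_iff hM.aemeasurable hclosed.measurableSet]
  have hi := integrable_seminorm_apply (p := p) hM hc hB y
  have hle : ∀ ω, N (B (M ω y)) ≤ N y := fun ω => (hB _).trans (hc ω y)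
  -- Equality in Jensen: a nonnegative function whose integral is at most 0 vanishes almost
  -- everywhere.
  have hint : ∫ ω, (N y - N (B (M ω y))) ∂p = 0 := by
    refine le_antisymm ?_ (integral_nonneg fun ω => sub_nonneg.2 (hle ω))
    rw [integral_sub (integrable_const _) hi]
    have := seminorm_apply_integral_le hM hMi hc hB y
    rw [hy, hBy] at this
    simpa using this
  have h0 := (integral_eq_zero_iff_of_nonneg (fun ω => sub_nonneg.2 (hle ω))
    ((integrable_const _).sub hi)).1 hint
  filter_upwards [h0] with ω hω
  exact (sub_eq_zero.1 hω).symm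

/-- The fixed vectors of the mean operator are the multiples of the common invariant vector. -/
lemma exists_eq_smul_of_integral_apply_eq (hN : ∀ x, N x = 0 → x = 0) (hM : Measurable M)
    (hMi : Integrable M p) (hc : ∀ ω, IsContraction N (M ω)) (hinv : ∀ ω, M ω ψS = ψS)
    (hψS : ψS ≠ 0) (hE : 0 < p {ω | M ω ∈ ME d}) {x : Vec d} (hx : (∫ ω, M ω ∂p) x = x) :
    ∃ c : ℂ, x = c • ψS := by
  -- The complement of the support is null for the law, so a set of positive outer measure meets the
  -- support; measurability of `ME` plays no role.
  obtain ⟨ω₀, hME, hsupp⟩ : ∃ ω, M ω ∈ ME d ∧ M ω ∈ (p.map M).support := by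
    by_contra! hcon
    refine hE.ne' (measure_mono_null (t := {ω | ¬ M ω ∈ (p.map M).support}) hcon ?_)
    exact ae_of_ae_map hM.aemeasurable (Measure.support_mem_ae (μ := p.map M))
  obtain ⟨-, hspec, hrank⟩ := hME
  set A := M ω₀
  have hA : IsContraction N A := hc ω₀
  set P := spectralProj A 1
  have hTψ : (∫ ω, M ω ∂p) ψS = ψS := by
    have h := (ContinuousLinearMap.apply ℂ (Vec d) ψS).integral_comp_comm hMi
    have h' : ∫ ω, M ω ψS ∂p = (∫ ω, M ω ∂p) ψS := h
    rw [← h']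
    simp [hinv]
  have hnorm : ∀ y, (∫ ω, M ω ∂p) y = y → N (P y) = N y := by
    intro y hy
    have hpow : ∀ n : ℕ, N ((A ^ n) y) = N y := by
      intro n
      induction n with
      | zero => rfl
      | succ n ih =>
        rw [pow_succ]
        exact seminorm_apply_eq_of_mem_support hM hMi hc hy (hA.pow n) ih hsupp
    have hlim : Tendsto (fun n => N ((A ^ n) y)) atTop (𝓝 (N (P y))) :=
      ((continuous_seminorm N).comp
        (ContinuousLinearMap.apply ℂ (Vec d) y).continuous).continuousAt.tendsto.comp
        (hA.tendsto_pow hN hspec.subset)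
    simp_rw [hpow] at hlim
    exact tendsto_nhds_unique hlim tendsto_const_nhds |>.symm ▸ rfl
  have hAψ : ψS ∈ Module.End.maxGenEigenspace (A : Vec d →ₗ[ℂ] Vec d) 1 := by
    rw [Module.End.mem_maxGenEigenspace]
    exact ⟨1, by simp [A, hinv]⟩
  obtain ⟨c, hcx⟩ : ∃ c : ℂ, P x = c • ψS := by
    have hne : (⟨ψS, hAψ⟩ : Module.End.maxGenEigenspace (A : Vec d →ₗ[ℂ] Vec d) 1) ≠ 0 :=
      fun h => hψS (congrArg Subtype.val h)
    obtain ⟨c, hc⟩ := (finrank_eq_one_iff_of_nonzero' _ hne).1 hrank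
      ⟨P x, spectralProj_apply_mem A 1 x⟩
    exact ⟨c, (congrArg Subtype.val hc).symm⟩
  refine ⟨c, ?_⟩
  -- Px is a multiple of ψS, which T fixes, so norm preservation under P applies to x - Px, a vector
  -- that P kills.
  have hfix : (∫ ω, M ω ∂p) (x - P x) = x - P x := by
    rw [map_sub, hx, hcx, map_smul, hTψ]
  have hPP : P (P x) = P x := DFunLike.congr_fun (spectralProj_mul_self A 1) x
  have h0 := hnorm _ hfix
  rw [map_sub, hPP, sub_self, map_zero] at h0
  rw [← hcx]
  exact sub_eq_zero.1 (hN _ h0.symm)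

end Mean

/-! ### Invariant vector, M_Q, telescoping, mean of ψ -/

section RandomProducts

variable {d : ℕ} {Ω : Type*} {M : Ω → Op d} {ψS : Vec d}

lemma Psi_apply_invariant (hinv : ∀ ω, M ω ψS = ψS) (n : ℕ) (ω : ℕ → Ω) :
    Psi M n ω ψS = ψS := by
  induction n with
  | zero => rfl
  | succ n ih =>
    rw [Psi_succ]
    change Psi M n ω (M (ω n) ψS) = ψS
    rw [hinv, ih]

lemma inner_psi (M : Ω → Op d) (ψS : Vec d) (ω : Ω) (x : Vec d) :
    ⟪psi M ψS ω, x⟫_ℂ = ⟪ψS, spectralProj (M ω) 1 x⟫_ℂ :=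
  ContinuousLinearMap.adjoint_inner_left _ _ _

/-- From P M = P one gets Q M = M - |ψS⟩⟨ψ|. This already annihilates ψS, so the right factor Q
changes nothing. -/
lemma MQ_eq {N : Seminorm ℂ (Vec d)} (hN : ∀ x, N x = 0 → x = 0)
    (hc : ∀ ω, IsContraction N (M ω)) (hinv : ∀ ω, M ω ψS = ψS) (hψS : ‖ψS‖ = 1) (ω : Ω) :
    MQ M ψS ω = M ω - ketbra ψS ψS * spectralProj (M ω) 1 := by
  set k := ketbra ψS ψS with hk
  set P := spectralProj (M ω) 1
  have hQ : Q M ψS ω = 1 - k * P := by rw [Q, psi, ketbra_adjoint]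
  have hMk : M ω * k = k := by
    ext1 x
    change M ω (k x) = k x
    rw [hk, ketbra_apply, map_smul, hinv]
  have hPk : P * k = k := by
    ext1 x
    change P (k x) = k x
    rw [hk, ketbra_apply, map_smul, spectralProj_eq_self_of_apply_eq (hinv ω)]
  have hkk : k * k = k := by
    ext1 x
    change k (k x) = k x
    have hψψ : ⟪ψS, ψS⟫_ℂ = 1 := by rw [inner_self_eq_norm_sq_to_K, hψS]; simp
    rw [hk, ketbra_apply ψS ψS x, map_smul, ketbra_apply, hψψ, one_smul]
  have hPM : P * M ω = P := (hc ω).spectralProj_mul hN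
  rw [MQ, hQ]
  have h1 : (1 - k * P) * M ω = M ω - k * P := by
    rw [sub_mul, one_mul, mul_assoc, hPM]
  have h2 : M ω * (k * P) = k * P := by rw [← mul_assoc, hMk]
  have h3 : k * P * (k * P) = k * P := by
    rw [mul_assoc k P, ← mul_assoc P k, hPk, ← mul_assoc, hkk]
  rw [h1, mul_sub, mul_one, sub_mul, h2, h3, sub_self, sub_zero]

/-- Replacing Ψ_{k+1}T by Ψ_k T in the sum costs only the boundary term (Ψ_n - 1)T, which is
bounded; what remains are martingale increments. -/
lemma sum_range_Psi_succ_mul (M : Ω → Op d) (T : Op d) (ω : ℕ → Ω) (n : ℕ) :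
    ∑ k ∈ Finset.range n, Psi M (k + 1) ω * (1 - T) =
      ∑ k ∈ Finset.range n, Psi M k ω * (M (ω k) - T) + (1 - Psi M n ω) * T := by
  induction n with
  | zero => simp [Psi_zero]
  | succ n ih =>
    rw [Finset.sum_range_succ, ih, Finset.sum_range_succ, Psi_succ]
    simp only [mul_sub, sub_mul, mul_one, one_mul, mul_assoc]
    abel

lemma sum_Icc_one_eq_sum_range {E : Type*} [AddCommMonoid E] (u : ℕ → E) (n : ℕ) :
    ∑ k ∈ Finset.Icc 1 n, u k = ∑ k ∈ Finset.range n, u (k + 1) := by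
  induction n with
  | zero => simp
  | succ n ih => rw [Finset.sum_Icc_succ_top (by omega), ih, Finset.sum_range_succ]

variable [MeasurableSpace Ω]

lemma measurable_psi {N : Seminorm ℂ (Vec d)} (hN : ∀ x, N x = 0 → x = 0) (hM : Measurable M)
    (hc : ∀ ω, IsContraction N (M ω)) (ψS : Vec d) : Measurable (psi M ψS) := by
  have h : Continuous fun A : Op d => ContinuousLinearMap.adjoint A ψS :=
    (ContinuousLinearMap.apply ℂ (Vec d) ψS).continuous.comp
      (ContinuousLinearMap.adjoint (𝕜 := ℂ) (E := Vec d) (F := Vec d)).continuous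
  exact h.measurable.comp (measurable_spectralProj hN hM hc)

/-- The adjoint is only conjugate linear, so it is taken out of the integral by testing against
vectors. -/
lemma integral_psi {p : Measure Ω} (hψ : Integrable (psi M ψS) p)
    (hP : Integrable (fun ω => spectralProj (M ω) 1) p) :
    ∫ ω, psi M ψS ω ∂p =
      ContinuousLinearMap.adjoint (∫ ω, spectralProj (M ω) 1 ∂p) ψS := by
  refine ext_inner_left ℂ fun x => ?_
  rw [ContinuousLinearMap.adjoint_inner_right, ← integral_inner hψ]
  have h1 : ∀ ω, ⟪x, psi M ψS ω⟫_ℂ = (starRingEnd ℂ) ⟪ψS, spectralProj (M ω) 1 x⟫_ℂ := fun ω => by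
    rw [← inner_psi, inner_conj_symm]
  simp_rw [h1]
  have h2 : ∫ ω, spectralProj (M ω) 1 x ∂p = (∫ ω, spectralProj (M ω) 1 ∂p) x :=
    (ContinuousLinearMap.apply ℂ (Vec d) x).integral_comp_comm hP
  have h3 : Integrable (fun ω => spectralProj (M ω) 1 x) p :=
    (ContinuousLinearMap.apply ℂ (Vec d) x).integrable_comp hP
  rw [integral_conj, integral_inner h3, h2, inner_conj_symm]

end RandomProducts

end RRDP

/-! ### The ergodic theorem -/

open scoped InnerProductSpace in
theorem theorem1p3 {d : ℕ} {Ω : Type*} [MeasurableSpace Ω] (p : Measure Ω)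
    [IsProbabilityMeasure p] (M : Ω → RRDP.Op d) (ψS : RRDP.Vec d)
    (hM : RRDP.IsRRDO M ψS) (hE : 0 < p {ω | M ω ∈ RRDP.ME d}) :
    -- the expectations and the inverse that enter the limit exist
    Integrable M p ∧ Integrable (RRDP.psi M ψS) p ∧ Integrable (RRDP.MQ M ψS) p ∧
    IsUnit (1 - ContinuousLinearMap.adjoint (∫ ω, RRDP.MQ M ψS ω ∂p)) ∧
    -- the three expressions for `θ` agree
    RRDP.theta M ψS p =
      ContinuousLinearMap.adjoint (RRDP.spectralProj (∫ ω, M ω ∂p) 1)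
        (∫ ω, RRDP.psi M ψS ω ∂p) ∧
    RRDP.theta M ψS p =
      ContinuousLinearMap.adjoint (RRDP.spectralProj (∫ ω, M ω ∂p) 1) ψS ∧
    -- almost sure convergence of the Cesàro means and the value of the limit
    (∀ᵐ ω ∂(Measure.infinitePi fun _ : ℕ => p),
      Tendsto (fun N : ℕ => (N : ℂ)⁻¹ • ∑ n ∈ Finset.Icc 1 N, RRDP.Psi M n ω) atTop
        (𝓝 (RRDP.ketbra ψS (RRDP.theta M ψS p)))) ∧
    RRDP.ketbra ψS (RRDP.theta M ψS p) = RRDP.spectralProj (∫ ω, M ω ∂p) 1 := by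
  obtain ⟨N, hN, hc⟩ := hM.contraction
  have hc : ∀ ω, RRDP.IsContraction N (M ω) := hc
  have hinv := hM.invariant
  have hψ1 := hM.normalized
  have hψ0 : ψS ≠ 0 := by
    rintro rfl
    simp at hψ1
  have hψψ : ⟪ψS, ψS⟫_ℂ = 1 := by rw [inner_self_eq_norm_sq_to_K, hψ1]; simp
  obtain ⟨K, hK, hb⟩ := RRDP.exists_norm_le_of_isContraction hN
  have hMi : Integrable M p :=
    .of_bound hM.measurable.aestronglyMeasurable K (ae_of_all _ fun ω => hb _ (hc ω))
  have hPb : ∀ ω, ‖RRDP.spectralProj (M ω) 1‖ ≤ K := fun ω => (hc ω).norm_spectralProj_le hN hb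
  have hPi : Integrable (fun ω => RRDP.spectralProj (M ω) 1) p :=
    .of_bound (RRDP.measurable_spectralProj hN hM.measurable hc).aestronglyMeasurable K
      (ae_of_all _ hPb)
  have hψi : Integrable (RRDP.psi M ψS) p := by
    refine .of_bound (RRDP.measurable_psi hN hM.measurable hc ψS).aestronglyMeasurable K
      (ae_of_all _ fun ω => ?_)
    refine (ContinuousLinearMap.le_opNorm _ _).trans ?_
    rw [hψ1, mul_one, LinearIsometryEquiv.norm_map]
    exact hPb ω
  have hMQ : RRDP.MQ M ψS = fun ω =>
      M ω - RRDP.ketbra ψS ψS * RRDP.spectralProj (M ω) 1 :=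
    funext (RRDP.MQ_eq hN hc hinv hψ1)
  have hMQi : Integrable (RRDP.MQ M ψS) p := by
    rw [hMQ]
    exact hMi.sub (hPi.const_mul _)
  set T : RRDP.Op d := ∫ ω, M ω ∂p
  set η : RRDP.Vec d := ∫ ω, RRDP.psi M ψS ω ∂p with hη
  set P : RRDP.Op d := RRDP.spectralProj T 1
  set θ : RRDP.Vec d := ContinuousLinearMap.adjoint P ψS
  have hT : RRDP.IsContraction N T := RRDP.isContraction_integral hM.measurable hMi hc
  have hTψ : T ψS = ψS := by
    have h : ∫ ω, M ω ψS ∂p = T ψS :=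
      (ContinuousLinearMap.apply ℂ (RRDP.Vec d) ψS).integral_comp_comm hMi
    rw [← h]
    simp [hinv]
  have hfix : ∀ x, T x = x → ∃ c : ℂ, x = c • ψS := fun x hx =>
    RRDP.exists_eq_smul_of_integral_apply_eq hN hM.measurable hMi hc hinv hψ0 hE hx
  have hPψ : P ψS = ψS := RRDP.spectralProj_eq_self_of_apply_eq hTψ
  have hθ : ∀ x, ⟪θ, x⟫_ℂ = ⟪ψS, P x⟫_ℂ := fun x =>
    ContinuousLinearMap.adjoint_inner_left _ _ _
  have hθT : ∀ x, ⟪θ, T x⟫_ℂ = ⟪θ, x⟫_ℂ := fun x => by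
    rw [hθ, hθ]
    congr 1
    exact DFunLike.congr_fun (hT.spectralProj_mul hN) x
  have hθψ : ⟪θ, ψS⟫_ℂ = 1 := by rw [hθ, hPψ, hψψ]
  -- The range of P is fixed by T, hence lies on the line of ψS; pairing with ψS reads off the
  -- coefficient.
  have hP : ∀ x, P x = ⟪θ, x⟫_ℂ • ψS := fun x => by
    obtain ⟨c, hcx⟩ := hfix (P x) (DFunLike.congr_fun (hT.mul_spectralProj hN) x)
    rw [hθ, hcx, inner_smul_right, hψψ, mul_one]
  have hPket : RRDP.ketbra ψS θ = P := by
    ext1 x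
    rw [RRDP.ketbra_apply, hP]
  have hEMQ : ∫ ω, RRDP.MQ M ψS ω ∂p = T - RRDP.ketbra ψS η := by
    rw [hMQ, integral_sub hMi (hPi.const_mul _), integral_const_mul_of_integrable hPi, hη,
      RRDP.integral_psi hψi hPi, RRDP.ketbra_adjoint]
  have hηψ : ⟪η, ψS⟫_ℂ = 1 := by
    have h : (∫ ω, RRDP.spectralProj (M ω) 1 ∂p) ψS = ψS := by
      have h : ∫ ω, RRDP.spectralProj (M ω) 1 ψS ∂p = (∫ ω, RRDP.spectralProj (M ω) 1 ∂p) ψS :=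
        (ContinuousLinearMap.apply ℂ (RRDP.Vec d) ψS).integral_comp_comm hPi
      rw [← h]
      simp [RRDP.spectralProj_eq_self_of_apply_eq (hinv _)]
    rw [hη, RRDP.integral_psi hψi hPi, ContinuousLinearMap.adjoint_inner_left, h, hψψ]
  have hunit : IsUnit (1 - ContinuousLinearMap.adjoint (∫ ω, RRDP.MQ M ψS ω ∂p)) := by
    have h : IsUnit (1 - ∫ ω, RRDP.MQ M ψS ω ∂p) := by
      refine RRDP.isUnit_of_injective fun x hx => ?_
      have hx' : x = T x - ⟪η, x⟫_ℂ • ψS := by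
        rw [hEMQ] at hx
        have h : x - (T x - RRDP.ketbra ψS η x) = 0 := hx
        rw [RRDP.ketbra_apply] at h
        exact sub_eq_zero.1 h
      -- Pairing with θ cancels T, because θ is fixed by the adjoint of T, and leaves only ⟨η, x⟩.
      -- So x is fixed by T, a multiple cψS with c = ⟨η, x⟩ = 0.
      have hηx : ⟪η, x⟫_ℂ = 0 := by
        have h := congrArg (fun y => ⟪θ, y⟫_ℂ) hx'
        simp only [inner_sub_right, inner_smul_right, hθT, hθψ, mul_one] at h
        linear_combination h
      rw [hηx, zero_smul, sub_zero] at hx'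
      obtain ⟨c, rfl⟩ := hfix x hx'.symm
      rw [inner_smul_right, hηψ, mul_one] at hηx
      rw [hηx, zero_smul]
    have hs : star (1 - ∫ ω, RRDP.MQ M ψS ω ∂p) =
        1 - ContinuousLinearMap.adjoint (∫ ω, RRDP.MQ M ψS ω ∂p) :=
      (star_sub (1 : RRDP.Op d) _).trans (by rw [star_one]; rfl)
    rw [← hs]
    exact h.star
  -- θ is fixed by the adjoint of T, so only the rank one term survives; it equals η because ⟨θ, ψS⟩
  -- = 1.
  have hUθ : (1 - ContinuousLinearMap.adjoint (∫ ω, RRDP.MQ M ψS ω ∂p)) θ = η := by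
    refine ext_inner_right ℂ fun x => ?_
    rw [sub_apply, one_apply_eq_self, inner_sub_left,
      ContinuousLinearMap.adjoint_inner_left (∫ ω, RRDP.MQ M ψS ω ∂p), hEMQ, sub_apply,
      RRDP.ketbra_apply, inner_sub_right, inner_smul_right, hθT, hθψ]
    ring
  have htheta : RRDP.theta M ψS p = θ := by
    rw [RRDP.theta, ← hη, ← hUθ]
    exact DFunLike.congr_fun (Ring.inverse_mul_cancel _ hunit) θ
  have hPη : ContinuousLinearMap.adjoint P η = θ := by
    refine ext_inner_right ℂ fun x => ?_
    rw [ContinuousLinearMap.adjoint_inner_left, hP, inner_smul_right, hηψ, mul_one]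
  rw [htheta, hPη, hPket]
  refine ⟨hMi, hψi, hMQi, hunit, rfl, rfl, ?_, rfl⟩
  filter_upwards [RRDP.ae_tendsto_cesaro_Psi_mul_sub p hM.measurable (fun ω => hb _ (hc ω))
    fun n ω => hb _ (RRDP.isContraction_Psi hc n ω)] with ω hω
  simp_rw [RRDP.sum_Icc_one_eq_sum_range]
  refine hT.tendsto_cesaro hN (fun n => ?_) ?_
  · ext1 x
    change RRDP.Psi M (n + 1) ω (P x) = P x
    rw [hP, map_smul, RRDP.Psi_apply_invariant hinv]
  · simp_rw [RRDP.sum_range_Psi_succ_mul, smul_add]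
    rw [← add_zero (0 : RRDP.Op d)]
    refine hω.add (RRDP.tendsto_inv_smul_of_norm_le (C := (K + K) * K) fun n => ?_)
    refine (norm_mul_le _ _).trans (mul_le_mul ?_ (hb _ hT) (norm_nonneg _) (by positivity))
    exact (norm_sub_le _ _).trans (add_le_add (hb _ RRDP.IsContraction.one)
      (hb _ (RRDP.isContraction_Psi hc n ω)))
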